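/- **Setting.** Let $P\in\mathbb R^{N\times N}$ be entrywise non-negative with spectral radius $\rho(P)=1$, let $V$ be a strictly positive left eigenvector of $P$, and let $B\in\mathbb R^N$ satisfy $\sigma_v(B)=\sum_i v_i b_i=0$. For a square matrix $A$ let $A_i=I-J_i+AJ_i$, where $J_i$ has a single nonzero entry, a $1$ at position $(i,i)$. A *negative diffusion step* for $A$ at the node $i$ maps a pair $(F,H)$ to $(A_iF,\;H+J_iF)$ if $F_i<0$, and leaves it unchanged otherwise. A sequence of selected nodes is *fair* for a set of nodes if each node of the set occurs infinitely often. *Sequential scheme.* Start from $(F_0,H_0)=(B,0)$ and perform negative diffusion steps for $P$ at the nodes of a fair sequence $(i_n)$. *Distributed scheme.* The nodes $\{1,\dots,N\}$ are partitioned into $\Omega_1,\dots,\Omega_K$ ($K\ge1$ arbitrary), and $P_{kl}$ denotes the block of $P$ with rows in $\Omega_k$ and columns in $\Omega_l$. Processor $k$ keeps vectors $F^k_n,H^k_n\in\mathbb R^{\Omega_k}$ indexed by a common discrete time $n\ge0$, with $F^k_0=B|_{\Omega_k}$ and $H^k_0=0$. For $l\ne k$ and $m\ge1$, processor $l$ sends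 at time $T'_m$ the fluid $P_{kl}(H^l_{T'_m}-H^l_{T'_{m-1}})$ to processor $k$, which receives it at time $T_m\ge T'_m$; here $0=T'_0<T'_1<T'_2<\cdots$, the times depend on $(l,k)$, and messages may arrive out of order. Between times $n$ and $n+1$, processor $k$ adds to $F^k_n$ all fluid received at time $n$ and then either is idle or performs a negative diffusion step for $P_{kk}$ at a selected node of $\Omega_k$; the nodes it selects form a fair sequence for $\Omega_k$. Delays are bounded: there is $T$ such that $T_m-T'_m\le T$ and $T'_m-T'_{m-1}\le T$ for all $m\ge1$ and all pairs $(l,k)$. **Theorem.** 1. If the history $H_n$ of the sequential scheme converges for some fair sequence, with limit $H$, then it converges to the same $H$ for every fair sequence, and every distributed scheme as above converges to $H$: for each $k$, $H^k_n\to H|_{\Omega_k}$ as $n\to\infty$. 2. If $P$ is irreducible, or if $B=PX-X$ for some entrywise non-negative vector $X$ (for instance $B=Pe-e$ with $e=\frac1N(1,\dots,1)^T$), then such a limit $H$ exists: there is a vector $H$ to which the sequential scheme converges for every fair sequence, and to which every distributed scheme as above converges. -/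

import Mathlib

open Filter Topology

noncomputable section

namespace DIteration

open Matrix

variable {ι : Type*} [Fintype ι] [DecidableEq ι]

/-- The spectral radius `ρ(P)` of a real matrix: the largest modulus of a complex eigenvalue. -/
def rho (P : Matrix ι ι ℝ) : ENNReal :=
  spectralRadius ℂ (P.map (algebraMap ℝ ℂ))

/-- The weighted sum `σ_v(X) = ∑ i, v_i x_i`. -/
def sigma (v X : ι → ℝ) : ℝ := ∑ i, v i * X i

/-- The matrix `J_i`, whose only nonzero entry is a `1` at the `i`-th diagonal position. -/
def nodeProj (i : ι) : Matrix ι ι ℝ := Matrix.single i i 1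

/-- The diffusion operator `P_i = I - J_i + P J_i`. -/
def diffOp (P : Matrix ι ι ℝ) (i : ι) : Matrix ι ι ℝ := 1 - nodeProj i + P * nodeProj i

/-- One step of negative-fluid diffusion on a state `(F, H)` (fluid, history) at the selected
node `i`: the node is diffused only if its fluid is negative. -/
def negStep (P : Matrix ι ι ℝ) (i : ι) (s : (ι → ℝ) × (ι → ℝ)) : (ι → ℝ) × (ι → ℝ) :=
  if s.1 i < 0 then (diffOp P i *ᵥ s.1, s.2 + nodeProj i *ᵥ s.1) else s

/-- The state `(F_n, H_n)` of the sequential negative-fluid diffusion on `(P, B)`; the node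
selected at the `(n+1)`-st step is `I n`. -/
def seqState (P : Matrix ι ι ℝ) (B : ι → ℝ) (I : ℕ → ι) : ℕ → (ι → ℝ) × (ι → ℝ)
  | 0 => (B, 0)
  | n + 1 => negStep P (I n) (seqState P B I n)

/-- The history vector `H_n` of the sequential negative-fluid diffusion. -/
def seqHist (P : Matrix ι ι ℝ) (B : ι → ℝ) (I : ℕ → ι) (n : ℕ) : ι → ℝ :=
  (seqState P B I n).2

/-- A sequence of nodes is fair if every node occurs infinitely often. -/
def IsFairSeq (I : ℕ → ι) : Prop := ∀ i, ∃ᶠ n in atTop, I n = i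

/-! ### The asynchronous distributed scheme

A partition of the nodes among `K` processors is given by the map `own` that sends a node to the
processor in charge of it. -/

/-- The set `Ω_k` of the nodes of processor `k`. -/
abbrev Part {N K : ℕ} (own : Fin N → Fin K) (k : Fin K) : Type := {i : Fin N // own i = k}

/-- The block `P_{kl}`, with rows in `Ω_k` and columns in `Ω_l`. -/
def block {N K : ℕ} (own : Fin N → Fin K) (P : Matrix (Fin N) (Fin N) ℝ) (k l : Fin K) :
    Matrix (Part own k) (Part own l) ℝ :=
  P.submatrix Subtype.val Subtype.val

/-- A schedule of the asynchronous computation, on a common discrete clock.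

* `select k n` is the node of `Ω_k` that processor `k` selects in the tick from time `n` to time
  `n + 1`; `none` means that the processor is idle in this tick, so that processors may run at
  different and varying speeds.
* For `l ≠ k` and `m ≥ 1`, the `m`-th message from `l` to `k` is sent at time `send l k m` and
  received at time `recv l k m`. Messages need not arrive in the order in which they are sent.
  `send l k 0 = 0` is the start of the computation, not a message, and `recv l k 0` is unused. -/
structure Schedule {N K : ℕ} (own : Fin N → Fin K) where
  select : (k : Fin K) → ℕ → Option (Part own k)
  send : Fin K → Fin K → ℕ → ℕ
  recv : Fin K → Fin K → ℕ → ℕ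
  send_zero : ∀ l k, l ≠ k → send l k 0 = 0
  send_strictMono : ∀ l k, l ≠ k → StrictMono (send l k)
  send_le_recv : ∀ l k, l ≠ k → ∀ m, send l k (m + 1) ≤ recv l k (m + 1)

/-- Every processor selects each of its nodes infinitely often. -/
def Schedule.IsFair {N K : ℕ} {own : Fin N → Fin K} (S : Schedule own) : Prop :=
  ∀ (k : Fin K) (i : Part own k), ∃ᶠ n in atTop, S.select k n = some i

/-- The transmission delays, and the gaps between successive sending times, are at most `T`. -/
def Schedule.DelayLE {N K : ℕ} {own : Fin N → Fin K} (S : Schedule own) (T : ℕ) : Prop :=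
  ∀ l k, l ≠ k → ∀ m,
    S.recv l k (m + 1) ≤ S.send l k (m + 1) + T ∧ S.send l k (m + 1) ≤ S.send l k m + T

/-- The fluid that processor `k` receives at time `n`, when the local histories are `H`: the
`m`-th message from `l` carries `P_{kl}` applied to the increment of the history of `l` between
the `(m-1)`-st and the `m`-th sending time. (The message with number `m + 1` is received at a
time `≥ m + 1`, so that `m < n` runs through all messages received at time `n`.) -/
def received {N K : ℕ} {own : Fin N → Fin K} (S : Schedule own)
    (P : Matrix (Fin N) (Fin N) ℝ) (H : (k : Fin K) → ℕ → Part own k → ℝ)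
    (k : Fin K) (n : ℕ) : Part own k → ℝ :=
  ∑ l ∈ Finset.univ.filter (fun l => l ≠ k),
    ∑ m ∈ (Finset.range n).filter (fun m => S.recv l k (m + 1) = n),
      block own P k l *ᵥ (H l (S.send l k (m + 1)) - H l (S.send l k m))

/-- `F k n` and `H k n` are the local fluid and history vectors of processor `k` at time `n` in
the distributed negative-fluid diffusion on `(P, B)` with schedule `S`. In each tick a processor
adds the received fluid to its own; then, unless idle, it performs a negative-fluid diffusion
step with its diagonal block `P_{kk}` at the selected node. -/
structure IsDistRun {N K : ℕ} {own : Fin N → Fin K} (S : Schedule own)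
    (P : Matrix (Fin N) (Fin N) ℝ) (B : Fin N → ℝ)
    (F H : (k : Fin K) → ℕ → Part own k → ℝ) : Prop where
  fluid_zero : ∀ k, F k 0 = fun i => B i.1
  hist_zero : ∀ k, H k 0 = 0
  step_idle : ∀ k n, S.select k n = none →
    (F k (n + 1), H k (n + 1)) = (F k n + received S P H k n, H k n)
  step_select : ∀ k n (i : Part own k), S.select k n = some i →
    (F k (n + 1), H k (n + 1)) =
      negStep (block own P k k) i (F k n + received S P H k n, H k n)

/-- The distributed run with local histories `H` converges to the vector `X`: on each `Ω_k`, the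
history of processor `k` converges to the restriction of `X`. -/
def DistTendsto {N K : ℕ} {own : Fin N → Fin K} (H : (k : Fin K) → ℕ → Part own k → ℝ)
    (X : Fin N → ℝ) : Prop :=
  ∀ k, Tendsto (H k) atTop (𝓝 (fun i => X i.1))

/-- Every fair sequential run of the negative-fluid diffusion on `(P, B)` converges to `X`. -/
def SeqLimit (P : Matrix ι ι ℝ) (B X : ι → ℝ) : Prop :=
  ∀ I : ℕ → ι, IsFairSeq I → Tendsto (seqHist P B I) atTop (𝓝 X)

/-- Every fair distributed run with bounded delays of the negative-fluid diffusion on `(P, B)`,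
with any number of processors and any partition of the nodes, converges to `X`. -/
def DistLimit {N : ℕ} (P : Matrix (Fin N) (Fin N) ℝ) (B X : Fin N → ℝ) : Prop :=
  ∀ (K : ℕ) (own : Fin N → Fin K) (S : Schedule own) (T : ℕ), S.IsFair → S.DelayLE T →
    ∀ F H : (k : Fin K) → ℕ → Part own k → ℝ, IsDistRun S P B F H → DistTendsto H X

end DIteration

end

/-!
Call `Y ≤ 0` a *barrier* if its residual fluid `B + P Y - Y` is non-negative. In every scheme the
history starts at `0`, never increases, and stays above every barrier: a diffusion at node `i`
replaces `h i` by a value that is at least `(B + P h) i`, and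
`(B + P h) i ≥ (B + P Y) i ≥ Y i` as long as `h ≥ Y` (`IsNegRelaxation.barrier_le`). A limit of the
history is itself a barrier, since a negative limit fluid at some node would be diffused there
infinitely often (`IsNegRelaxation.limit_isBarrier`). Hence the history converges as soon as there
is a barrier, and its limit is the greatest barrier
(`IsNegRelaxation.exists_tendsto_isGreatest`), whatever the order of the diffusions. Conversely,
one convergent fair run provides a barrier.

The argument only needs that the fluid observed at the diffused node is at least the residual fluid
of the true history, and has the same limit. In a distributed run it is the residual fluid of the
history as known to the processor (`IsDistRun.fluid_eq`). As histories decrease, the increments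
still in transit are non-positive, so this partial history lies above the true one (`le_view`);
as delays and sending gaps are at most `T`, it lies below the history at time `n - 2 T`, so the two
have the same limit (`tendsto_view`).

A barrier exists in both cases of the second part. If `B = P X - X` with `X ≥ 0`, take `-X`. If
`P` is irreducible, the left eigenvalue of `V` is `ρ(P) = 1`, the fixed vectors of `P` form a line
spanned by a positive vector `U`, and by rank-nullity the range of `P - 1` is the hyperplane
`σ_V = 0`; so `B = P Z - Z`, and adding a multiple of `U` makes `Z` non-negative.
-/

namespace DIteration

open Matrix

/-! ### Negative relaxations and their barriers -/

/-- A barrier of the fluid problem `(P, B)`: a non-positive vector `Y` at which the residual fluid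
`B + P Y - Y` is non-negative. -/
structure IsBarrier {ι : Type*} [Fintype ι] (P : Matrix ι ι ℝ) (B Y : ι → ℝ) : Prop where
  nonpos : Y ≤ 0
  residual_nonneg : 0 ≤ B + P *ᵥ Y - Y

lemma mulVec_le_mulVec {ι : Type*} [Fintype ι] {P : Matrix ι ι ℝ} (hP : ∀ i j, 0 ≤ P i j)
    {Y Z : ι → ℝ} (h : Y ≤ Z) : P *ᵥ Y ≤ P *ᵥ Z :=
  fun i => Finset.sum_le_sum fun j _ => mul_le_mul_of_nonneg_left (h j) (hP i j)

/-- A history `h` driven by an observed fluid `g`: at time `n` each node `i` with `sel n i` absorbs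
the negative part of `g n i`, and all other nodes rest. In a distributed run several nodes may be
selected at the same time, and `g` may differ from the residual of `h`. -/
structure IsNegRelaxation {ι : Type*} (sel : ℕ → ι → Prop) (g h : ℕ → ι → ℝ) : Prop where
  hist_zero : h 0 = 0
  step_of_sel : ∀ n i, sel n i → h (n + 1) i = h n i + min (g n i) 0
  step_of_not_sel : ∀ n i, ¬ sel n i → h (n + 1) i = h n i

namespace IsNegRelaxation

variable {ι : Type*} {sel : ℕ → ι → Prop} {g h : ℕ → ι → ℝ}

lemma antitone (hr : IsNegRelaxation sel g h) : Antitone h := by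
  refine antitone_nat_of_succ_le fun n i => ?_
  by_cases hs : sel n i
  · rw [hr.step_of_sel n i hs]
    linarith [min_le_right (g n i) 0]
  · exact (hr.step_of_not_sel n i hs).le

lemma nonpos (hr : IsNegRelaxation sel g h) (n : ℕ) : h n ≤ 0 :=
  hr.hist_zero ▸ hr.antitone (Nat.zero_le n)

/-- At a selected node the new history is at least the smaller of the old one and
`B + P h ≥ B + P Y ≥ Y`, so the history never crosses a barrier. -/
lemma barrier_le [Fintype ι] (hr : IsNegRelaxation sel g h) {P : Matrix ι ι ℝ} {B Y : ι → ℝ}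
    (hP : ∀ i j, 0 ≤ P i j) (hY : IsBarrier P B Y)
    (hg : ∀ n, B + P *ᵥ h n - h n ≤ g n) (n : ℕ) : Y ≤ h n := by
  induction n with
  | zero => exact hr.hist_zero ▸ hY.nonpos
  | succ n ih =>
    intro i
    by_cases hs : sel n i
    · rw [hr.step_of_sel n i hs]
      have h1 := mulVec_le_mulVec hP ih i
      have h2 := hY.residual_nonneg i
      have h3 := hg n i
      have h4 := ih i
      simp only [Pi.add_apply, Pi.sub_apply, Pi.zero_apply] at h2 h3
      rcases min_choice (g n i) 0 with h5 | h5 <;> rw [h5] <;> linarith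
    · exact (hr.step_of_not_sel n i hs).symm ▸ ih i

/-- If the fluid converged to a negative value at some node, each of the infinitely many
selections of this node would lower its history by a fixed amount. -/
lemma fluid_limit_nonneg (hr : IsNegRelaxation sel g h) (hfair : ∀ i, ∃ᶠ n in atTop, sel n i)
    {X G : ι → ℝ} (hX : Tendsto h atTop (𝓝 X)) (hG : Tendsto g atTop (𝓝 G)) : 0 ≤ G := by
  intro i
  by_contra! hneg
  have hXi := tendsto_pi_nhds.1 hX i
  have hGi := tendsto_pi_nhds.1 hG i
  have hdiff : Tendsto (fun n => h (n + 1) i - h n i) atTop (𝓝 0) := by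
    simpa using ((tendsto_add_atTop_iff_nat 1).2 hXi).sub hXi
  have hneg' : G i < 0 := hneg
  have e1 := hGi.eventually_lt_const (show G i < G i / 2 by linarith)
  have e2 := hdiff.eventually_const_lt (show G i / 2 < 0 by linarith)
  obtain ⟨n, hs, h1, h2⟩ := ((hfair i).and_eventually (e1.and e2)).exists
  rw [hr.step_of_sel n i hs] at h2
  linarith [min_le_left (g n i) 0]

lemma limit_isBarrier [Fintype ι] (hr : IsNegRelaxation sel g h)
    (hfair : ∀ i, ∃ᶠ n in atTop, sel n i) {P : Matrix ι ι ℝ} {B X : ι → ℝ}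
    (hX : Tendsto h atTop (𝓝 X)) (hG : Tendsto g atTop (𝓝 (B + P *ᵥ X - X))) :
    IsBarrier P B X :=
  ⟨le_of_tendsto' hX hr.nonpos, hr.fluid_limit_nonneg hfair hX hG⟩

/-- An antitone history above a barrier converges, to a barrier that dominates every other one. -/
lemma exists_tendsto_isGreatest [Fintype ι] (hr : IsNegRelaxation sel g h)
    (hfair : ∀ i, ∃ᶠ n in atTop, sel n i) {P : Matrix ι ι ℝ} {B Y : ι → ℝ}
    (hP : ∀ i j, 0 ≤ P i j) (hg : ∀ n, B + P *ᵥ h n - h n ≤ g n)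
    (hG : ∀ X, Tendsto h atTop (𝓝 X) → Tendsto g atTop (𝓝 (B + P *ᵥ X - X)))
    (hY : IsBarrier P B Y) :
    ∃ X, Tendsto h atTop (𝓝 X) ∧ IsGreatest {Z | IsBarrier P B Z} X := by
  have hX : Tendsto h atTop (𝓝 (fun i => ⨅ n, h n i)) := by
    refine tendsto_pi_nhds.2 fun i => tendsto_atTop_ciInf (fun m n hmn => hr.antitone hmn i) ?_
    exact ⟨Y i, by rintro _ ⟨n, rfl⟩; exact hr.barrier_le hP hY hg n i⟩
  exact ⟨_, hX, hr.limit_isBarrier hfair hX (hG _ hX),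
    fun Z hZ => ge_of_tendsto' hX (hr.barrier_le hP hZ hg)⟩

end IsNegRelaxation

lemma tendsto_residual {ι : Type*} [Fintype ι] (P : Matrix ι ι ℝ) (B : ι → ℝ) {h : ℕ → ι → ℝ}
    {X : ι → ℝ} (hX : Tendsto h atTop (𝓝 X)) :
    Tendsto (fun n => B + P *ᵥ h n - h n) atTop (𝓝 (B + P *ᵥ X - X)) := by
  have hc : Continuous fun Z : ι → ℝ => B + P *ᵥ Z - Z :=
    (continuous_const.add (continuous_const.matrix_mulVec continuous_id)).sub continuous_id
  exact (hc.tendsto X).comp hX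

/-! ### The sequential scheme -/

section Sequential

variable {ι : Type*} [Fintype ι] [DecidableEq ι]

lemma negStep_eq (P : Matrix ι ι ℝ) (i : ι) (s : (ι → ℝ) × (ι → ℝ)) :
    negStep P i s = (s.1 + (P *ᵥ Pi.single i (min (s.1 i) 0) - Pi.single i (min (s.1 i) 0)),
      s.2 + Pi.single i (min (s.1 i) 0)) := by
  have hJ : nodeProj i *ᵥ s.1 = Pi.single i (s.1 i) := by
    rw [nodeProj, Matrix.single_mulVec, one_mul]
    rfl
  unfold negStep
  split_ifs with hs
  · rw [min_eq_left hs.le, diffOp, add_mulVec, sub_mulVec, one_mulVec, ← mulVec_mulVec, hJ]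
    congr 1
    abel
  · simp [min_eq_right (not_lt.1 hs)]

lemma seqState_fst (P : Matrix ι ι ℝ) (B : ι → ℝ) (I : ℕ → ι) (n : ℕ) :
    (seqState P B I n).1 = B + P *ᵥ seqHist P B I n - seqHist P B I n := by
  induction n with
  | zero => simp [seqState, seqHist]
  | succ n ih =>
    unfold seqHist at ih ⊢
    rw [seqState, negStep_eq]
    dsimp only
    rw [ih, mulVec_add]
    abel

lemma isNegRelaxation_seqHist (P : Matrix ι ι ℝ) (B : ι → ℝ) (I : ℕ → ι) :
    IsNegRelaxation (fun n i => I n = i) (fun n => (seqState P B I n).1) (seqHist P B I) where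
  hist_zero := rfl
  step_of_sel := by
    rintro n _ rfl
    simp [seqHist, seqState, negStep_eq]
  step_of_not_sel := by
    intro n i hi
    simp [seqHist, seqState, negStep_eq, Pi.single_eq_of_ne' hi]

lemma tendsto_seqState_fst {P : Matrix ι ι ℝ} {B : ι → ℝ} {I : ℕ → ι} {X : ι → ℝ}
    (hX : Tendsto (seqHist P B I) atTop (𝓝 X)) :
    Tendsto (fun n => (seqState P B I n).1) atTop (𝓝 (B + P *ᵥ X - X)) := by
  simpa only [seqState_fst] using tendsto_residual P B hX

lemma isBarrier_of_tendsto_seqHist {P : Matrix ι ι ℝ} {B : ι → ℝ} {I : ℕ → ι} (hI : IsFairSeq I)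
    {X : ι → ℝ} (hX : Tendsto (seqHist P B I) atTop (𝓝 X)) : IsBarrier P B X :=
  (isNegRelaxation_seqHist P B I).limit_isBarrier hI hX (tendsto_seqState_fst hX)

lemma exists_tendsto_seqHist {P : Matrix ι ι ℝ} (hP : ∀ i j, 0 ≤ P i j) {B : ι → ℝ} {I : ℕ → ι}
    (hI : IsFairSeq I) {Y : ι → ℝ} (hY : IsBarrier P B Y) :
    ∃ X, Tendsto (seqHist P B I) atTop (𝓝 X) ∧ IsGreatest {Z | IsBarrier P B Z} X :=
  (isNegRelaxation_seqHist P B I).exists_tendsto_isGreatest hI hP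
    (fun n => (seqState_fst P B I n).ge) (fun _ => tendsto_seqState_fst) hY

lemma seqLimit_of_isGreatest {P : Matrix ι ι ℝ} (hP : ∀ i j, 0 ≤ P i j) {B X : ι → ℝ}
    (hX : IsGreatest {Z | IsBarrier P B Z} X) : SeqLimit P B X := by
  intro I hI
  obtain ⟨Z, hZ, hZ'⟩ := exists_tendsto_seqHist hP hI hX.1
  rwa [hX.unique hZ']

end Sequential

/-! ### Sums of delivered increments -/

/-- The sum of the increments of `x` between consecutive sending times `s`, over all messages
received up to time `n`. -/
def delivered (s r : ℕ → ℕ) (x : ℕ → ℝ) (n : ℕ) : ℝ :=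
  ∑ m ∈ (Finset.range n).filter (fun m => r (m + 1) ≤ n), (x (s (m + 1)) - x (s m))

section Delivered

variable {s r : ℕ → ℕ} {x : ℕ → ℝ}

lemma delivered_succ (hs : StrictMono s) (hsr : ∀ m, s (m + 1) ≤ r (m + 1)) (n : ℕ) :
    delivered s r x (n + 1) = delivered s r x n +
      ∑ m ∈ (Finset.range (n + 1)).filter (fun m => r (m + 1) = n + 1),
        (x (s (m + 1)) - x (s m)) := by
  unfold delivered
  rw [← Finset.sum_union]
  · refine Finset.sum_congr (Finset.ext fun m => ?_) fun _ _ => rfl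
    simp only [Finset.mem_filter, Finset.mem_range, Finset.mem_union]
    have h1 := hs.le_apply (x := m + 1)
    have h2 := hsr m
    omega
  · refine Finset.disjoint_left.2 fun m h1 h2 => ?_
    have := (Finset.mem_filter.1 h1).2
    have := (Finset.mem_filter.1 h2).2
    omega

/-- Messages still in transit carry non-positive increments, so what has been delivered is at
least the total change of `x` up to now. -/
lemma le_delivered (hx : Antitone x) (hs : StrictMono s) (hs0 : s 0 = 0)
    (hsr : ∀ m, s (m + 1) ≤ r (m + 1)) (n : ℕ) : x n - x 0 ≤ delivered s r x n := by
  -- Truncating the sending times at `n` gives a telescoping sum that leaves the increments of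
  -- all delivered messages unchanged.
  have htel : ∑ m ∈ Finset.range n, (x (min (s (m + 1)) n) - x (min (s m) n)) = x n - x 0 := by
    rw [Finset.sum_range_sub (fun m => x (min (s m) n)), hs0, Nat.zero_min,
      min_eq_right hs.le_apply]
  rw [← htel, delivered, Finset.sum_filter]
  refine Finset.sum_le_sum fun m _ => ?_
  have hm : s m < s (m + 1) := hs (Nat.lt_succ_self m)
  split_ifs with hr
  · have := hsr m
    rw [min_eq_left (by omega), min_eq_left (by omega)]
  · exact sub_nonpos.2 (hx (min_le_min_right n hm.le))

/-- With delays and sending gaps at most `T`, everything that happened until time `n - 2 T` has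
been delivered at time `n`. -/
lemma delivered_le (hx : Antitone x) (hs : StrictMono s) (hs0 : s 0 = 0) {T : ℕ}
    (hr : ∀ m, r (m + 1) ≤ s (m + 1) + T) (hgap : ∀ m, s (m + 1) ≤ s m + T) (n : ℕ) :
    delivered s r x n ≤ x (n - 2 * T) - x 0 := by
  -- `M` is the number of the last message sent until time `n - T`.
  obtain ⟨M, hM, hM'⟩ : ∃ M, s M ≤ n - T ∧ n - T < s (M + 1) := by
    have hex : ∃ M, n - T < s (M + 1) := ⟨n, lt_of_lt_of_le (by omega) hs.le_apply⟩
    classical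
    refine ⟨Nat.find hex, ?_, Nat.find_spec hex⟩
    rcases h0 : Nat.find hex with _ | M
    · rw [hs0]
      exact Nat.zero_le _
    · exact not_lt.1 (Nat.find_min hex (m := M) (by omega))
  have hsub : Finset.range M ⊆ (Finset.range n).filter (fun m => r (m + 1) ≤ n) := by
    intro m hm
    have h1 : s (m + 1) ≤ s M := hs.monotone (Finset.mem_range.1 hm)
    have h2 := hs.le_apply (x := m + 1)
    have h3 := hr m
    simp only [Finset.mem_filter, Finset.mem_range]
    omega
  have h1 : delivered s r x n ≤ ∑ m ∈ Finset.range M, (x (s (m + 1)) - x (s m)) := by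
    rw [← neg_le_neg_iff, delivered, ← Finset.sum_neg_distrib, ← Finset.sum_neg_distrib]
    refine Finset.sum_le_sum_of_subset_of_nonneg hsub fun m _ _ => ?_
    rw [neg_sub, sub_nonneg]
    exact hx (hs (Nat.lt_succ_self m)).le
  rw [Finset.sum_range_sub (fun m => x (s m)), hs0] at h1
  have h2 := hgap M
  have h3 : x (s M) ≤ x (n - 2 * T) := hx (by omega)
  linarith

lemma tendsto_delivered (hx : Antitone x) (hx0 : x 0 = 0) (hs : StrictMono s) (hs0 : s 0 = 0)
    (hsr : ∀ m, s (m + 1) ≤ r (m + 1)) {T : ℕ} (hr : ∀ m, r (m + 1) ≤ s (m + 1) + T)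
    (hgap : ∀ m, s (m + 1) ≤ s m + T) {a : ℝ} (ha : Tendsto x atTop (𝓝 a)) :
    Tendsto (delivered s r x) atTop (𝓝 a) := by
  refine tendsto_of_tendsto_of_tendsto_of_le_of_le ha
    (ha.comp (tendsto_sub_atTop_nat (2 * T))) (fun n => ?_) fun n => ?_
  · simpa [hx0] using le_delivered hx hs hs0 hsr n
  · simpa [hx0] using delivered_le hx hs hs0 hr hgap n

end Delivered

/-! ### The distributed scheme -/

section Distributed

variable {N K : ℕ} {own : Fin N → Fin K}

/-- The global vector made up of one local vector per processor. -/
def glue (own : Fin N → Fin K) (x : (k : Fin K) → Part own k → ℝ) : Fin N → ℝ :=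
  fun i => x (own i) ⟨i, rfl⟩

lemma glue_coe (x : (k : Fin K) → Part own k → ℝ) (k : Fin K) (i : Part own k) :
    glue own x i.1 = x k i := by
  obtain ⟨i, rfl⟩ := i
  rfl

lemma sum_block_mulVec (P : Matrix (Fin N) (Fin N) ℝ) (x : (k : Fin K) → Part own k → ℝ)
    (k : Fin K) (i : Part own k) :
    ∑ l, (block own P k l *ᵥ x l) i = (P *ᵥ glue own x) i.1 := by
  simp only [mulVec, dotProduct]
  rw [← (Equiv.sigmaFiberEquiv own).sum_comp, Fintype.sum_sigma]
  refine Finset.sum_congr rfl fun l _ => Finset.sum_congr rfl fun j _ => ?_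
  exact congrArg (P i.1 j.1 * ·) (glue_coe x l j).symm

/-- What processor `k` knows at time `n` of the global history `h`: its own part, and for every
other node the increments that have reached it. -/
def view (S : Schedule own) (h : ℕ → Fin N → ℝ) (k : Fin K) (n : ℕ) : Fin N → ℝ :=
  fun j => if own j = k then h n j else
    delivered (S.send (own j) k) (S.recv (own j) k) (fun m => h m j) n

/-- The increments of the history at the nodes of the other processors that reach processor `k`
at time `n`. -/
def arrivals (S : Schedule own) (h : ℕ → Fin N → ℝ) (k : Fin K) (n : ℕ) : Fin N → ℝ :=
  fun j => if own j = k then 0 else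
    ∑ m ∈ (Finset.range n).filter (fun m => S.recv (own j) k (m + 1) = n),
      (h (S.send (own j) k (m + 1)) j - h (S.send (own j) k m) j)

lemma view_succ (S : Schedule own) (h : ℕ → Fin N → ℝ) (k : Fin K) (n : ℕ) :
    view S h k (n + 1) = view S h k n + arrivals S h k (n + 1) +
      fun j => if own j = k then h (n + 1) j - h n j else 0 := by
  ext j
  by_cases hj : own j = k
  · simp [view, arrivals, hj]
  · simp [view, arrivals, hj,
      delivered_succ (S.send_strictMono (own j) k hj) (S.send_le_recv (own j) k hj)]

lemma le_view (S : Schedule own) {h : ℕ → Fin N → ℝ} (hh : Antitone h) (h0 : h 0 = 0)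
    (k : Fin K) (n : ℕ) : h n ≤ view S h k n := by
  intro j
  by_cases hj : own j = k
  · simp [view, hj]
  · have := le_delivered (x := fun m => h m j) (fun _ _ hab => hh hab j)
      (S.send_strictMono _ k hj) (S.send_zero _ k hj) (S.send_le_recv _ k hj) n
    simpa [view, hj, h0] using this

lemma tendsto_view {S : Schedule own} {T : ℕ} (hT : S.DelayLE T) {h : ℕ → Fin N → ℝ}
    (hh : Antitone h) (h0 : h 0 = 0) {X : Fin N → ℝ} (hX : Tendsto h atTop (𝓝 X)) (k : Fin K) :
    Tendsto (view S h k) atTop (𝓝 X) := by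
  refine tendsto_pi_nhds.2 fun j => ?_
  have hXj := tendsto_pi_nhds.1 hX j
  by_cases hj : own j = k
  · simpa [view, hj] using hXj
  · simpa [view, hj] using tendsto_delivered (x := fun m => h m j) (fun _ _ hab => hh hab j)
      (congrFun h0 j) (S.send_strictMono _ k hj) (S.send_zero _ k hj) (S.send_le_recv _ k hj)
      (fun m => (hT _ k hj m).1) (fun m => (hT _ k hj m).2) hXj

lemma received_apply (S : Schedule own) (P : Matrix (Fin N) (Fin N) ℝ)
    (H : (k : Fin K) → ℕ → Part own k → ℝ) (k : Fin K) (n : ℕ) (i : Part own k) :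
    received S P H k n i
      = (P *ᵥ arrivals S (fun n => glue own fun l => H l n) k n) i.1 := by
  have hglue : arrivals S (fun n => glue own fun l => H l n) k n
      = glue own fun l => if l = k then 0 else
        ∑ m ∈ (Finset.range n).filter (fun m => S.recv l k (m + 1) = n),
          (H l (S.send l k (m + 1)) - H l (S.send l k m)) := by
    ext j
    by_cases hj : own j = k <;> simp [arrivals, glue, hj]
  rw [hglue, ← sum_block_mulVec, received, Finset.sum_filter, Finset.sum_apply]
  refine Finset.sum_congr rfl fun l _ => ?_
  by_cases hl : l = k
  · simp [hl]
  · simp [hl, mulVec_sum, -Finset.sum_sub_distrib]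

namespace IsDistRun

variable {S : Schedule own} {P : Matrix (Fin N) (Fin N) ℝ} {B : Fin N → ℝ}
  {F H : (k : Fin K) → ℕ → Part own k → ℝ}

lemma fluid_succ (hrun : IsDistRun S P B F H) (k : Fin K) (n : ℕ) :
    F k (n + 1) = F k n + received S P H k n +
      (block own P k k *ᵥ (H k (n + 1) - H k n) - (H k (n + 1) - H k n)) := by
  rcases hs : S.select k n with _ | i
  · obtain ⟨h1, h2⟩ := Prod.ext_iff.1 (hrun.step_idle k n hs)
    simp only at h1 h2
    simp [h1, h2]
  · obtain ⟨h1, h2⟩ := Prod.ext_iff.1 (hrun.step_select k n i hs)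
    simp only [negStep_eq] at h1 h2
    rw [h1, h2, add_sub_cancel_left]

/-- The fluid of processor `k`, after reception, is the residual fluid computed with the history
that processor `k` knows. -/
lemma fluid_eq (hrun : IsDistRun S P B F H) (k : Fin K) (n : ℕ) (i : Part own k) :
    (F k n + received S P H k n) i =
      (B + P *ᵥ view S (fun n => glue own fun l => H l n) k n
        - glue own fun l => H l n) i.1 := by
  induction n with
  | zero =>
    have h0 : (glue own fun l => H l 0) = 0 := by
      ext j
      simp [glue, hrun.hist_zero]
    have hv : view S (fun n => glue own fun l => H l n) k 0 = 0 := by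
      ext j
      simp [view, delivered, h0]
    simp [hv, h0, received, hrun.fluid_zero]
  | succ n ih =>
    have hblock : (block own P k k *ᵥ (H k (n + 1) - H k n)) i
        = (P *ᵥ fun j => if own j = k then
            glue own (fun l => H l (n + 1)) j - glue own (fun l => H l n) j else 0) i.1 := by
      have hglue : (fun j => if own j = k then
            glue own (fun l => H l (n + 1)) j - glue own (fun l => H l n) j else 0)
          = glue own fun l => if l = k then H l (n + 1) - H l n else 0 := by
        ext j
        by_cases hj : own j = k <;> simp [glue, hj]
      rw [hglue, ← sum_block_mulVec, Finset.sum_eq_single k]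
      · simp
      · intro l _ hl
        simp [hl]
      · simp
    rw [Pi.add_apply, received_apply, hrun.fluid_succ, view_succ, mulVec_add, mulVec_add]
    have e1 := glue_coe (fun l => H l n) k i
    have e2 := glue_coe (fun l => H l (n + 1)) k i
    simp only [Pi.add_apply, Pi.sub_apply] at ih hblock ⊢
    rw [hblock, ih, e1, e2]
    ring

lemma isNegRelaxation (hrun : IsDistRun S P B F H) :
    IsNegRelaxation (fun n i => S.select (own i) n = some ⟨i, rfl⟩)
      (fun n => glue own fun k => F k n + received S P H k n)
      (fun n => glue own fun k => H k n) where
  hist_zero := by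
    ext j
    simp [glue, hrun.hist_zero]
  step_of_sel := by
    intro n i hs
    have h2 := (Prod.ext_iff.1 (hrun.step_select (own i) n ⟨i, rfl⟩ hs)).2
    simp only [negStep_eq] at h2
    simp [glue, h2]
  step_of_not_sel := by
    intro n i hs
    rcases hsel : S.select (own i) n with _ | j
    · have h2 := (Prod.ext_iff.1 (hrun.step_idle (own i) n hsel)).2
      simp only at h2
      simp [glue, h2]
    · have hij : j ≠ ⟨i, rfl⟩ := fun h => hs (h ▸ hsel)
      have h2 := (Prod.ext_iff.1 (hrun.step_select (own i) n j hsel)).2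
      simp only [negStep_eq] at h2
      simp [glue, h2, Pi.single_eq_of_ne' hij]

lemma glue_fluid_apply (hrun : IsDistRun S P B F H) (n : ℕ) (i : Fin N) :
    (glue own fun k => F k n + received S P H k n) i =
      (B + P *ᵥ view S (fun n => glue own fun l => H l n) (own i) n
        - glue own fun l => H l n) i :=
  hrun.fluid_eq (own i) n ⟨i, rfl⟩

end IsDistRun

lemma distLimit_of_isGreatest {P : Matrix (Fin N) (Fin N) ℝ} (hP : ∀ i j, 0 ≤ P i j)
    {B X : Fin N → ℝ} (hX : IsGreatest {Z | IsBarrier P B Z} X) : DistLimit P B X := by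
  intro K own S T hfair hT F H hrun
  have hr := hrun.isNegRelaxation
  have hg : ∀ n, B + P *ᵥ (glue own fun k => H k n) - (glue own fun k => H k n)
      ≤ glue own fun k => F k n + received S P H k n := by
    intro n i
    rw [hrun.glue_fluid_apply]
    have h1 := mulVec_le_mulVec hP (le_view S hr.antitone hr.hist_zero (own i) n) i
    simpa using h1
  have hG : ∀ Z, Tendsto (fun n => glue own fun k => H k n) atTop (𝓝 Z) →
      Tendsto (fun n => glue own fun k => F k n + received S P H k n) atTop
        (𝓝 (B + P *ᵥ Z - Z)) := by
    intro Z hZ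
    refine tendsto_pi_nhds.2 fun i => ?_
    simp only [hrun.glue_fluid_apply]
    have hv := tendsto_view hT hr.antitone hr.hist_zero hZ (own i)
    have hc : Continuous fun W : Fin N → ℝ => P *ᵥ W :=
      continuous_const.matrix_mulVec continuous_id
    exact tendsto_pi_nhds.1 ((((hc.tendsto Z).comp hv).const_add B).sub hZ) i
  obtain ⟨Z, hZ, hZ'⟩ :=
    hr.exists_tendsto_isGreatest (fun i => hfair (own i) ⟨i, rfl⟩) hP hg hG hX.1
  rw [← hX.unique hZ'] at hZ
  intro k
  refine tendsto_pi_nhds.2 fun i => ?_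
  simpa only [glue_coe] using tendsto_pi_nhds.1 hZ i.1

end Distributed

/-! ### Barriers from Perron–Frobenius theory -/

section Perron

lemma isBarrier_neg {ι : Type*} [Fintype ι] (P : Matrix ι ι ℝ) {X : ι → ℝ} (hX : 0 ≤ X) :
    IsBarrier P (P *ᵥ X - X) (-X) :=
  ⟨neg_nonpos.2 hX, by rw [mulVec_neg]; exact le_of_eq (by abel)⟩

variable {ι : Type*} [Fintype ι] [DecidableEq ι]

lemma eigenvalue_le_rho {P : Matrix ι ι ℝ} {V : ι → ℝ} (hV : V ≠ 0) {μ : ℝ}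
    (hVP : V ᵥ* P = μ • V) : (‖μ‖₊ : ENNReal) ≤ rho P := by
  have hdet : (scalar ι μ - P).det = 0 := by
    refine exists_vecMul_eq_zero_iff.1 ⟨V, hV, ?_⟩
    rw [vecMul_sub, hVP]
    ext i
    simp
  have hspec : (μ : ℂ) ∈ spectrum ℂ (P.map (algebraMap ℝ ℂ)) := by
    rw [spectrum.mem_iff, Matrix.isUnit_iff_isUnit_det, isUnit_iff_ne_zero, not_not]
    have h1 : algebraMap ℂ (Matrix ι ι ℂ) (μ : ℂ) - P.map (algebraMap ℝ ℂ)
        = (algebraMap ℝ ℂ).mapMatrix (scalar ι μ - P) := by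
      ext i j
      by_cases hij : i = j <;> simp [hij, Matrix.algebraMap_matrix_apply]
    rw [h1, ← RingHom.map_det, hdet, map_zero]
  have := le_iSup₂ (f := fun (k : ℂ) (_ : k ∈ spectrum ℂ (P.map (algebraMap ℝ ℂ))) =>
    (‖k‖₊ : ENNReal)) (μ : ℂ) hspec
  simpa [rho, spectralRadius] using this

/-- Pairing `|λ| |x| ≤ P |x|` with the positive left eigenvector `V` gives `|λ| ≤ μ` for every
complex eigenvalue `λ`. -/
lemma rho_le_of_pos_left_eigenvector {P : Matrix ι ι ℝ} (hP : ∀ i j, 0 ≤ P i j) {V : ι → ℝ}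
    (hV : ∀ i, 0 < V i) {μ : ℝ} (hVP : V ᵥ* P = μ • V) : rho P ≤ ENNReal.ofReal μ := by
  refine iSup₂_le fun k hk => ?_
  rw [spectrum.mem_iff, Matrix.isUnit_iff_isUnit_det, isUnit_iff_ne_zero, not_not] at hk
  obtain ⟨x, hx, hx'⟩ := exists_mulVec_eq_zero_iff.2 hk
  rw [sub_mulVec, sub_eq_zero, algebraMap_eq_diagonal] at hx'
  have h1 : ‖k‖ • (fun i => ‖x i‖) ≤ P *ᵥ (fun i => ‖x i‖) := by
    intro i
    have h2 := congrFun hx' i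
    rw [mulVec_diagonal] at h2
    calc ‖k‖ * ‖x i‖ = ‖((P.map (algebraMap ℝ ℂ)) *ᵥ x) i‖ := by rw [← h2]; simp
      _ ≤ ∑ j, ‖P.map (algebraMap ℝ ℂ) i j * x j‖ := norm_sum_le _ _
      _ = (P *ᵥ (fun i => ‖x i‖)) i :=
        Finset.sum_congr rfl fun j _ => by simp [abs_of_nonneg (hP i j)]
  have h3 : ‖k‖ * (V ⬝ᵥ fun i => ‖x i‖) ≤ μ * (V ⬝ᵥ fun i => ‖x i‖) := by
    rw [← smul_eq_mul, ← smul_eq_mul, ← dotProduct_smul, ← smul_dotProduct, ← hVP,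
      ← dotProduct_mulVec]
    exact Finset.sum_le_sum fun i _ => mul_le_mul_of_nonneg_left (h1 i) (hV i).le
  obtain ⟨i, hi⟩ := Function.ne_iff.1 hx
  have h4 : 0 < V ⬝ᵥ fun i => ‖x i‖ :=
    Finset.sum_pos' (fun j _ => mul_nonneg (hV j).le (norm_nonneg _))
      ⟨i, Finset.mem_univ i, mul_pos (hV i) (norm_pos_iff.2 hi)⟩
  change ‖k‖ₑ ≤ _
  rw [← ofReal_norm k]
  exact ENNReal.ofReal_le_ofReal (le_of_mul_le_mul_right h3 h4)

lemma left_eigenvalue_eq_one [Nonempty ι] {P : Matrix ι ι ℝ} (hP : ∀ i j, 0 ≤ P i j)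
    (hrho : rho P = 1) {V : ι → ℝ} (hV : ∀ i, 0 < V i) {μ : ℝ} (hVP : V ᵥ* P = μ • V) :
    μ = 1 := by
  have hV0 : V ≠ 0 := fun h0 => (hV (Classical.arbitrary ι)).ne' (by rw [h0]; rfl)
  have h1 := rho_le_of_pos_left_eigenvector hP hV hVP
  have h2 := eigenvalue_le_rho hV0 hVP
  rw [hrho] at h1 h2
  refine le_antisymm ?_ (ENNReal.one_le_ofReal.1 h1)
  exact (le_abs_self μ).trans (by exact_mod_cast h2)

/-- A non-negative fixed vector of an irreducible matrix vanishes everywhere or nowhere. -/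
lemma eq_zero_of_fixed_of_apply_eq_zero {P : Matrix ι ι ℝ} (hirr : P.IsIrreducible) {U : ι → ℝ}
    (hU : 0 ≤ U) (hPU : P *ᵥ U = U) {i : ι} (hi : U i = 0) : U = 0 := by
  ext j
  obtain ⟨k, -, hk⟩ := (isIrreducible_iff_exists_pow_pos hirr.nonneg).1 hirr i j
  have hpow : ∀ m : ℕ, (P ^ m) *ᵥ U = U := by
    intro m
    induction m with
    | zero => simp
    | succ m ih => rw [pow_succ, ← mulVec_mulVec, hPU, ih]
  have h1 : ∑ l, (P ^ k) i l * U l = 0 := (congrFun (hpow k) i).trans hi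
  have h2 := (Finset.sum_eq_zero_iff_of_nonneg fun l _ =>
    mul_nonneg (pow_apply_nonneg hirr.nonneg k i l) (hU l)).1 h1 j (Finset.mem_univ j)
  exact (mul_eq_zero.1 h2).resolve_left hk.ne'

lemma exists_pos_fixed [Nonempty ι] {P : Matrix ι ι ℝ} (hirr : P.IsIrreducible) {V : ι → ℝ}
    (hV : ∀ i, 0 < V i) (hVP : V ᵥ* P = V) : ∃ U : ι → ℝ, (∀ i, 0 < U i) ∧ P *ᵥ U = U := by
  have hV0 : V ≠ 0 := fun h0 => (hV (Classical.arbitrary ι)).ne' (by rw [h0]; rfl)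
  have hdet : (P - 1).det = 0 :=
    exists_vecMul_eq_zero_iff.1 ⟨V, hV0, by rw [vecMul_sub, vecMul_one, hVP, sub_self]⟩
  obtain ⟨W, hW, hPW⟩ := exists_mulVec_eq_zero_iff.2 hdet
  rw [sub_mulVec, one_mulVec, sub_eq_zero] at hPW
  -- `|W| ≤ P |W|`, and both sides have the same pairing with the positive vector `V`.
  have hle : ∀ i, 0 ≤ (P *ᵥ |W|) i - |W| i := by
    intro i
    rw [sub_nonneg]
    calc |W| i = |∑ j, P i j * W j| := congrArg abs (congrFun hPW i).symm
      _ ≤ ∑ j, |P i j * W j| := Finset.abs_sum_le_sum_abs _ _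
      _ = (P *ᵥ |W|) i :=
        Finset.sum_congr rfl fun j _ => by simp [abs_mul, abs_of_nonneg (hirr.nonneg i j)]
  have hsum : ∑ i, V i * ((P *ᵥ |W|) i - |W| i) = 0 := by
    change V ⬝ᵥ (P *ᵥ |W| - |W|) = 0
    rw [dotProduct_sub, dotProduct_mulVec, hVP, sub_self]
  have hfix : P *ᵥ |W| = |W| := by
    ext i
    have h1 := (Finset.sum_eq_zero_iff_of_nonneg fun i _ =>
      mul_nonneg (hV i).le (hle i)).1 hsum i (Finset.mem_univ i)
    exact sub_eq_zero.1 ((mul_eq_zero.1 h1).resolve_left (hV i).ne')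
  refine ⟨|W|, fun i => lt_of_le_of_ne (abs_nonneg (W i)) fun h0 => hW ?_, hfix⟩
  ext j
  exact abs_eq_zero.1 (congrFun (eq_zero_of_fixed_of_apply_eq_zero hirr (abs_nonneg W) hfix h0.symm) j)

/-- The fixed vectors of an irreducible matrix are the multiples of the positive one. -/
lemma fixed_eq_smul [Nonempty ι] {P : Matrix ι ι ℝ} (hirr : P.IsIrreducible) {U W : ι → ℝ}
    (hU : ∀ i, 0 < U i) (hPU : P *ᵥ U = U) (hPW : P *ᵥ W = W) : ∃ c : ℝ, c • U = W := by
  -- `W - c U` is non-negative with a zero entry for the smallest quotient `c` of entries.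
  obtain ⟨i, hi⟩ := Finite.exists_min fun i => W i / U i
  refine ⟨W i / U i, (sub_eq_zero.1 ?_).symm⟩
  refine eq_zero_of_fixed_of_apply_eq_zero hirr (i := i) (fun j => ?_) ?_ ?_
  · have := (le_div_iff₀ (hU j)).1 (hi j)
    simpa using this
  · rw [mulVec_sub, mulVec_smul, hPU, hPW]
  · simp [(hU i).ne']

/-- The range of `P - 1` lies in the hyperplane orthogonal to `V`, and fills it by rank-nullity
because the kernel is a line. -/
lemma exists_mulVec_sub_eq [Nonempty ι] {P : Matrix ι ι ℝ} (hirr : P.IsIrreducible) {U V : ι → ℝ}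
    (hV : ∀ i, 0 < V i) (hVP : V ᵥ* P = V) (hU : ∀ i, 0 < U i) (hPU : P *ᵥ U = U) {B : ι → ℝ}
    (hB : V ⬝ᵥ B = 0) : ∃ Z, P *ᵥ Z - Z = B := by
  let f : (ι → ℝ) →ₗ[ℝ] (ι → ℝ) := P.mulVecLin - LinearMap.id
  let φ : Module.Dual ℝ (ι → ℝ) := dotProductBilin ℝ ℝ V
  have hf : ∀ Z, f Z = P *ᵥ Z - Z := fun _ => rfl
  have hφ : ∀ Z, φ Z = V ⬝ᵥ Z := fun _ => rfl
  have hφ0 : φ ≠ 0 := by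
    intro h0
    have h1 : V ⬝ᵥ V = 0 := (hφ V).symm.trans (by rw [h0]; rfl)
    have h2 := dotProduct_self_eq_zero.1 h1
    exact (hV (Classical.arbitrary ι)).ne' (by rw [h2]; rfl)
  have hle : LinearMap.range f ≤ LinearMap.ker φ := by
    rintro _ ⟨Z, rfl⟩
    rw [LinearMap.mem_ker, hφ, hf, dotProduct_sub, dotProduct_mulVec, hVP, sub_self]
  have hker : Module.finrank ℝ (LinearMap.ker f) = 1 := by
    refine (finrank_eq_one_iff_of_nonzero' (⟨U, by simp [hf, hPU]⟩ : LinearMap.ker f) ?_).2 ?_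
    · intro h0
      have h1 : U = 0 := congrArg Subtype.val h0
      exact (hU (Classical.arbitrary ι)).ne' (by rw [h1]; rfl)
    · rintro ⟨W, hW⟩
      rw [LinearMap.mem_ker, hf, sub_eq_zero] at hW
      obtain ⟨c, hc⟩ := fixed_eq_smul hirr hU hPU hW
      exact ⟨c, Subtype.ext hc⟩
  have h1 := LinearMap.finrank_range_add_finrank_ker f
  have h2 := Module.Dual.finrank_ker_add_one_of_ne_zero hφ0
  have heq := Submodule.eq_of_le_of_finrank_eq hle (by omega)
  have hmem : B ∈ LinearMap.range f := by rw [heq, LinearMap.mem_ker, hφ, hB]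
  exact hmem

lemma exists_isBarrier_of_isIrreducible [Nonempty ι] {P : Matrix ι ι ℝ} (hirr : P.IsIrreducible)
    {V : ι → ℝ} (hV : ∀ i, 0 < V i) (hVP : V ᵥ* P = V) {B : ι → ℝ} (hB : V ⬝ᵥ B = 0) :
    ∃ Y, IsBarrier P B Y := by
  obtain ⟨U, hU, hPU⟩ := exists_pos_fixed hirr hV hVP
  obtain ⟨Z, rfl⟩ := exists_mulVec_sub_eq hirr hV hVP hU hPU hB
  -- Adding a suitable multiple of the positive fixed vector to `Z` makes it non-negative.
  obtain ⟨i, hi⟩ := Finite.exists_min fun i => Z i / U i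
  have hnonneg : 0 ≤ Z - (Z i / U i) • U := by
    intro j
    have := (le_div_iff₀ (hU j)).1 (hi j)
    simpa using this
  refine ⟨-(Z - (Z i / U i) • U), ?_⟩
  have h1 := isBarrier_neg P hnonneg
  rwa [show P *ᵥ (Z - (Z i / U i) • U) - (Z - (Z i / U i) • U) = P *ᵥ Z - Z by
    rw [mulVec_sub, mulVec_smul, hPU]; abel] at h1

end Perron

end DIteration

theorem mainTheorem4 {N : ℕ} (P : Matrix (Fin N) (Fin N) ℝ)
    (hP : ∀ i j, 0 ≤ P i j)
    (hrho : DIteration.rho P = 1)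
    (V : Fin N → ℝ) (hV : ∀ i, 0 < V i)
    (μ : ℝ) (hVP : Matrix.vecMul V P = μ • V)
    (B : Fin N → ℝ) (hB : DIteration.sigma V B = 0) :
    -- the limit of one fair sequential run is the limit of all sequential and distributed ones
    (∀ Hlim : Fin N → ℝ, ∀ I : ℕ → Fin N, DIteration.IsFairSeq I →
      Tendsto (DIteration.seqHist P B I) atTop (𝓝 Hlim) →
        DIteration.SeqLimit P B Hlim ∧ DIteration.DistLimit P B Hlim) ∧
    -- the limit exists if `P` is irreducible or `B = P X - X` with `X ≥ 0`
    ((P.IsIrreducible ∨ ∃ X : Fin N → ℝ, (∀ i, 0 ≤ X i) ∧ B = Matrix.mulVec P X - X) →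
      ∃ Hlim : Fin N → ℝ, DIteration.SeqLimit P B Hlim ∧ DIteration.DistLimit P B Hlim) := by
  constructor
  · intro Hlim I hI hlim
    obtain ⟨X, hX, hgreat⟩ := DIteration.exists_tendsto_seqHist hP hI
      (DIteration.isBarrier_of_tendsto_seqHist hI hlim)
    obtain rfl := tendsto_nhds_unique hX hlim
    exact ⟨DIteration.seqLimit_of_isGreatest hP hgreat,
      DIteration.distLimit_of_isGreatest hP hgreat⟩
  · intro hcase
    -- Without nodes there is only one vector.
    rcases isEmpty_or_nonempty (Fin N) with hN | hN
    · exact ⟨0, fun I _ => hN.elim (I 0), fun K own S T _ _ F H _ k =>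
        tendsto_pi_nhds.2 fun i => hN.elim i.1⟩
    obtain ⟨Y, hY⟩ : ∃ Y, DIteration.IsBarrier P B Y := by
      rcases hcase with hirr | ⟨X, hX, rfl⟩
      · obtain rfl := DIteration.left_eigenvalue_eq_one hP hrho hV hVP
        rw [one_smul] at hVP
        exact DIteration.exists_isBarrier_of_isIrreducible hirr hV hVP hB
      · exact ⟨-X, DIteration.isBarrier_neg P hX⟩
    -- Any fair run, such as the one that enumerates the nodes cyclically, has the greatest
    -- barrier as its limit.
    obtain ⟨I, hI⟩ : ∃ I : ℕ → Fin N, DIteration.IsFairSeq I := by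
      have : NeZero N := ⟨Fin.pos_iff_nonempty.2 hN |>.ne'⟩
      refine ⟨fun n => Fin.ofNat N n, fun i => frequently_atTop.2 fun a => ?_⟩
      refine ⟨i + N * a, ?_, ?_⟩
      · nlinarith [Nat.pos_of_ne_zero (NeZero.ne N), Nat.zero_le i.1]
      · ext
        simp [Fin.ofNat, Nat.mod_eq_of_lt i.2]
    obtain ⟨X, -, hgreat⟩ := DIteration.exists_tendsto_seqHist hP hI hY
    exact ⟨X, DIteration.seqLimit_of_isGreatest hP hgreat,
      DIteration.distLimit_of_isGreatest hP hgreat⟩
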